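/- For a finite graph $G$, let $\alpha(G)$ denote the maximum size of an independent set of $G$, and let $bc(G)$ denote the minimum number of complete bipartite subgraphs of $G$ such that each edge of $G$ belongs to exactly one of them. There exists an absolute constant $c>0$ such that, for the binomial random graph $G=G(n,1/2)$ on $n$ labelled vertices (each pair of vertices is an edge independently with probability $1/2$), $$ bc(G)\;\le\; n-(2+2c)\log_2 n\;\le\; n-(1+c)\,\alpha(G) $$ with high probability, that is, the probability that both inequalities hold tends to $1$ as $n\to\infty$. -/

import Mathlib

open Filter Topology

namespace SimpleGraph

variable {V : Type*}

/-- `H` is a complete bipartite graph: its edges are exactly the pairs with one end in `A` and the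
other in `B`, for two disjoint nonempty vertex sets `A`, `B` (the vertices of `V` outside `A ∪ B`
are isolated in `H`, so that `H` stands for a complete bipartite graph with vertex set `A ∪ B`). -/
def IsBiclique (H : SimpleGraph V) : Prop :=
  ∃ A B : Set V, A.Nonempty ∧ B.Nonempty ∧ Disjoint A B ∧
    ∀ u v, H.Adj u v ↔ (u ∈ A ∧ v ∈ B) ∨ (u ∈ B ∧ v ∈ A)

/-- `H 0, …, H (k - 1)` are complete bipartite subgraphs of `G`, and each edge of `G` belongs to
exactly one of them. -/
def IsBicliquePartition (G : SimpleGraph V) {k : ℕ} (H : Fin k → SimpleGraph V) : Prop :=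
  (∀ i, (H i).IsBiclique ∧ H i ≤ G) ∧ ∀ u v, G.Adj u v → ∃! i, (H i).Adj u v

/-- `bc(G)`: the minimum number of complete bipartite subgraphs of `G` such that each edge of `G`
belongs to exactly one of them. -/
noncomputable def bc (G : SimpleGraph V) : ℕ :=
  sInf {k | ∃ H : Fin k → SimpleGraph V, G.IsBicliquePartition H}

/-- A graph on a finite vertex set has a partition into bicliques (its single edges), so `bc` is
a minimum over a nonempty set. -/
theorem exists_isBicliquePartition [Finite V] (G : SimpleGraph V) :
    ∃ k, ∃ H : Fin k → SimpleGraph V, G.IsBicliquePartition H := by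
  classical
  obtain ⟨k, ⟨e⟩⟩ := Finite.exists_equiv_fin G.edgeSet
  refine ⟨k, fun i => fromEdgeSet {((e.symm i : G.edgeSet) : Sym2 V)}, fun i => ⟨?_, ?_⟩, ?_⟩
  · obtain ⟨x, hx⟩ : ∃ x, e.symm i = x := ⟨_, rfl⟩
    beta_reduce
    rw [hx]
    clear hx
    obtain ⟨x, hx⟩ := x
    induction x using Sym2.ind with
    | _ a b =>
      have hab : a ≠ b := G.ne_of_adj (by assumption)
      refine ⟨{a}, {b}, ⟨a, rfl⟩, ⟨b, rfl⟩, by simpa using hab, fun u v => ?_⟩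
      simp only [fromEdgeSet_adj, Set.mem_singleton_iff, Sym2.eq_iff]
      grind
  · intro u v h
    simp only [fromEdgeSet_adj, Set.mem_singleton_iff] at h
    have := (e.symm i).2
    rw [← h.1] at this
    exact this
  · intro u v h
    refine ⟨e ⟨s(u, v), h⟩, by simp [h.ne], fun j hj => ?_⟩
    simp only [fromEdgeSet_adj, Set.mem_singleton_iff] at hj
    rw [← e.symm_apply_eq]
    exact Subtype.ext hj.1.symm

/-- The minimum defining `bc` is attained. -/
theorem exists_isBicliquePartition_bc [Finite V] (G : SimpleGraph V) :
    ∃ H : Fin G.bc → SimpleGraph V, G.IsBicliquePartition H :=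
  Nat.sInf_mem G.exists_isBicliquePartition

end SimpleGraph

/-!
The independence number of `G(n, 1/2)` is at most `2 log₂ n` with high probability by the first
moment method, so it suffices to save `(2 + 1/25) log₂ n` bicliques over the trivial bound `n`.

Suppose that `G` contains `s + 2r` vertices consisting of an independent set of size `s` and `r`
pairs of twins, where the two vertices of a pair have the same neighbours among the `s + 2r`
vertices (`IsTwinCopy`). Removing the vertices outside this set by stars, and then the pairs one at a
time by bicliques with the pair as one side, leaves no edge, so `bc G ≤ n - s - r`
(`IsTwinCopy.bc_add_le`). With `s = (9/5) log₂ n` and `r = (1/4) log₂ n` this saves more than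
`2 log₂ n`. Such a copy exists because, for every set `T` of its vertices, containing `a` vertices of
the independent set and `b` full pairs, the conditions within `T` have rank at most
`a(a+1)/2 + b|T|`, and this is at most `(39/40) |T| log₂ n` (`two_pow_conditions_le`): no part of the
configuration is too rare.

For the second moment, graphs form a vector space over the field with two elements, and the graphs
in which a given placement `φ` is a twin copy form a subgroup `U φ`. If each placement is weighted
by the index of `U φ`, then the second moment is the sum of the indices of `U φ + U ψ`
(`AddSubgroup.card_avoiding_le`). Placements are taken partite, so that `φ` and `ψ` share exactly
the vertices on a set `T` of positions where they agree, and `U φ + U ψ` contains every graph that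
satisfies the conditions within `T` (`twinSubgroup_le_sup`). The index is therefore at most
`B ^ |T|` with `B = n ^ (39/40)`, and the sum over all `φ` and `ψ` factorizes: with parts of size `m`
and `k = s + 2r`, the probability that there is no copy is at most `(1 + (B - 1) / m) ^ k - 1`
(`binomialRandom_no_twinCopy_le`), which tends to `0`.
-/

/-! ### The second moment method over a finite abelian group -/

/-- The index form of `|U ∩ U'| |U + U'| = |U| |U'|`. -/
lemma AddSubgroup.index_mul_index_eq {Γ : Type*} [AddCommGroup Γ] (U U' : AddSubgroup Γ) :
    U.index * U'.index = (U ⊓ U').index * (U ⊔ U').index := by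
  have h1 : U.relIndex (U ⊔ U') * (U ⊔ U').index = U.index :=
    AddSubgroup.relIndex_mul_index le_sup_left
  have h2 : (U ⊓ U').relIndex U' * U'.index = (U ⊓ U').index :=
    AddSubgroup.relIndex_mul_index inf_le_right
  rw [AddSubgroup.inf_relIndex_right] at h2
  rw [AddSubgroup.relIndex_sup_left] at h1
  rw [← h1, ← h2]
  ring

open scoped Classical in
/-- Chebyshev's inequality for the number of subgroups `U x` that contain a uniformly random element,
each counted with weight the inverse of its probability: the weighted count has mean `|Φ|` and
second moment `∑ x y, [Γ : U x + U y]`. -/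
lemma AddSubgroup.card_avoiding_le {Γ Φ : Type*} [AddCommGroup Γ] [Fintype Γ] [Fintype Φ]
    (U : Φ → AddSubgroup Γ) :
    (Fintype.card Φ : ℝ) ^ 2 * (Finset.univ.filter fun g : Γ => ∀ x, g ∉ U x).card ≤
      Fintype.card Γ * ((∑ x, ∑ y, ((U x ⊔ U y).index : ℝ)) - (Fintype.card Φ : ℝ) ^ 2) := by
  set N : ℝ := (Fintype.card Φ : ℝ) with hN
  set X : Γ → ℝ := fun g => ∑ x, if g ∈ U x then ((U x).index : ℝ) else 0 with hX
  have hcard (W : AddSubgroup Γ) :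
      ((Finset.univ.filter fun g : Γ => g ∈ W).card : ℝ) * W.index = Fintype.card Γ := by
    have h := W.card_mul_index
    rw [Nat.card_eq_fintype_card (α := Γ), Nat.card_eq_fintype_card, Fintype.card_subtype] at h
    exact_mod_cast h
  have hmean : ∑ g, X g = N * Fintype.card Γ := by
    simp only [hX]
    rw [Finset.sum_comm]
    simp only [← Finset.sum_filter, Finset.sum_const, nsmul_eq_mul, hcard, Finset.card_univ, hN]
  have hsq : ∑ g, X g ^ 2 = Fintype.card Γ * ∑ x, ∑ y, ((U x ⊔ U y).index : ℝ) := by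
    have h (g : Γ) : X g ^ 2 = ∑ x, ∑ y, if g ∈ U x ⊓ U y then
        ((U x).index : ℝ) * (U y).index else 0 := by
      simp only [hX, sq, Finset.sum_mul_sum]
      refine Finset.sum_congr rfl fun x _ => Finset.sum_congr rfl fun y _ => ?_
      simp only [AddSubgroup.mem_inf]
      split_ifs <;> simp_all
    simp only [h]
    rw [Finset.sum_comm, Finset.mul_sum]
    refine Finset.sum_congr rfl fun x _ => ?_
    rw [Finset.sum_comm, Finset.mul_sum]
    refine Finset.sum_congr rfl fun y _ => ?_
    rw [← Finset.sum_filter, Finset.sum_const, nsmul_eq_mul, ← hcard (U x ⊓ U y)]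
    have := AddSubgroup.index_mul_index_eq (U x) (U y)
    have : ((U x).index : ℝ) * (U y).index = (U x ⊓ U y).index * (U x ⊔ U y).index := by
      exact_mod_cast this
    rw [this]
    ring
  have hvar : ∑ g, (X g - N) ^ 2 =
      Fintype.card Γ * ((∑ x, ∑ y, ((U x ⊔ U y).index : ℝ)) - N ^ 2) := by
    have h (g : Γ) : (X g - N) ^ 2 = X g ^ 2 - 2 * N * X g + N ^ 2 := by ring
    simp only [h, Finset.sum_add_distrib, Finset.sum_sub_distrib, ← Finset.mul_sum, hmean, hsq,
      Finset.sum_const, nsmul_eq_mul, Finset.card_univ]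
    ring
  rw [← hvar]
  calc N ^ 2 * ((Finset.univ.filter fun g : Γ => ∀ x, g ∉ U x).card : ℝ)
      = ∑ g ∈ Finset.univ.filter (fun g : Γ => ∀ x, g ∉ U x), (X g - N) ^ 2 := by
        rw [Finset.sum_congr rfl (g := fun _ => N ^ 2), Finset.sum_const, nsmul_eq_mul, mul_comm]
        intro g hg
        have : X g = 0 := Finset.sum_eq_zero fun x _ => if_neg ((Finset.mem_filter.1 hg).2 x)
        rw [this]
        ring
    _ ≤ ∑ g, (X g - N) ^ 2 :=
        Finset.sum_le_sum_of_subset_of_nonneg (Finset.filter_subset _ _) fun _ _ _ => sq_nonneg _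

namespace SimpleGraph

variable {V : Type*}

/-! ### Bounding `bc` by a labelling of the vertices -/

/-- Bicliques are required to have nonempty sides, but the empty members of a partition may be
dropped. -/
lemma bc_le_of_partition (G : SimpleGraph V) {K : ℕ} (H : Fin K → SimpleGraph V)
    (hH : ∀ i, H i ≠ ⊥ → (H i).IsBiclique) (hle : ∀ i, H i ≤ G)
    (hG : ∀ u v, G.Adj u v → ∃! i, (H i).Adj u v) : G.bc ≤ K := by
  classical
  set e := Fintype.equivFin {i // H i ≠ ⊥} with he
  have hk : Fintype.card {i // H i ≠ ⊥} ≤ K :=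
    (Fintype.card_subtype_le _).trans_eq (Fintype.card_fin K)
  refine le_trans (Nat.sInf_le ⟨fun j => H (e.symm j), fun j => ⟨hH _ (e.symm j).2, hle _⟩, ?_⟩) hk
  intro u v huv
  obtain ⟨i, hi, hu⟩ := hG u v huv
  have hne : H i ≠ ⊥ := fun h => by rw [h] at hi; exact hi
  refine ⟨e ⟨i, hne⟩, by simpa using hi, fun j hj => ?_⟩
  rw [← e.symm_apply_eq]
  exact Subtype.ext (hu _ hj)

/-- If every label class is independent and the vertices of a class have the same neighbours among
the vertices of larger label, then the edges whose smaller label is `j` form a biclique, for each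
`j` but the largest. -/
lemma bc_le_of_label (G : SimpleGraph V) (l : V → ℕ) (K : ℕ) (hl : ∀ v, l v ≤ K)
    (hindep : ∀ u v, l u = l v → ¬ G.Adj u v)
    (htwin : ∀ u v w, l u = l v → l u < l w → G.Adj u w → G.Adj v w) : G.bc ≤ K := by
  refine G.bc_le_of_partition (K := K)
    (fun j => { Adj := fun u v => G.Adj u v ∧ min (l u) (l v) = j
                symm := ⟨fun u v h => ⟨h.1.symm, by rw [min_comm]; exact h.2⟩⟩
                loopless := ⟨fun u h => G.irrefl h.1⟩ }) ?_ (fun i u v h => h.1) ?_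
  · intro j hj
    obtain ⟨a, b, hab⟩ := SimpleGraph.ne_bot_iff_exists_adj.1 hj
    have key : ∀ u v, G.Adj u v → min (l u) (l v) = j →
        (l u = j ∧ j < l v) ∨ (l v = j ∧ j < l u) := by
      intro u v h hm
      have := hindep u v
      rcases lt_trichotomy (l u) (l v) with h1 | h1 | h1
      · left; omega
      · exact absurd h (this h1)
      · right; omega
    have hne : {u | l u = j}.Nonempty ∧
        {w | (j : ℕ) < l w ∧ ∃ u, l u = j ∧ G.Adj u w}.Nonempty := by
      rcases key a b hab.1 hab.2 with h | h
      · exact ⟨⟨a, h.1⟩, ⟨b, h.2, a, h.1, hab.1⟩⟩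
      · exact ⟨⟨b, h.1⟩, ⟨a, h.2, b, h.1, hab.1.symm⟩⟩
    refine ⟨{u | l u = j}, {w | j < l w ∧ ∃ u, l u = j ∧ G.Adj u w}, hne.1, hne.2, ?_, ?_⟩
    · rw [Set.disjoint_left]
      intro u hu hu'
      exact absurd hu'.1 (by rw [Set.mem_ofPred_eq] at hu; omega)
    · intro u v
      constructor
      · rintro ⟨h, hm⟩
        rcases key u v h hm with h' | h'
        · exact Or.inl ⟨h'.1, h'.2, u, h'.1, h⟩
        · exact Or.inr ⟨⟨h'.2, v, h'.1, h.symm⟩, h'.1⟩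
      · have main : ∀ u v, l u = j → j < l v → (∃ w, l w = j ∧ G.Adj w v) →
            G.Adj u v ∧ min (l u) (l v) = j := by
          rintro u v hu hv ⟨w, hw, hwv⟩
          exact ⟨htwin w u v (hw.trans hu.symm) (by omega) hwv, by omega⟩
        rintro (⟨hu, hv, hw⟩ | ⟨⟨hu, hw⟩, hv⟩)
        · exact main u v hu hv hw
        · have := main v u hv hu hw
          exact ⟨this.1.symm, by rw [min_comm]; exact this.2⟩
  · intro u v h
    have hlt : min (l u) (l v) < K := by
      have := hindep u v
      have h1 := hl u
      have h2 := hl v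
      rcases lt_trichotomy (l u) (l v) with h3 | h3 | h3
      · omega
      · exact absurd h (this h3)
      · omega
    exact ⟨⟨_, hlt⟩, ⟨h, rfl⟩, fun i hi => Fin.ext hi.2.symm⟩

/-- `φ` places in `G` an independent set `ι` together with pairs of twins indexed by `π`: the two
vertices of each pair have the same neighbours within the range of `φ`. As `G` has no loops, they
are not adjacent to each other. -/
def IsTwinCopy {ι π : Type*} (G : SimpleGraph V) (φ : ι ⊕ π × Bool → V) : Prop :=
  (∀ i j, ¬ G.Adj (φ (.inl i)) (φ (.inl j))) ∧
    ∀ u p, G.Adj (φ u) (φ (.inr (p, false))) ↔ G.Adj (φ u) (φ (.inr (p, true)))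

/-- Each vertex outside the copy is the centre of a star, each pair of twins is one side of a
biclique, and nothing is left. -/
lemma IsTwinCopy.bc_add_le [Fintype V] {G : SimpleGraph V} {s r : ℕ}
    {φ : Fin s ⊕ Fin r × Bool → V} (h : G.IsTwinCopy φ) (hφ : Function.Injective φ) :
    G.bc + (s + r) ≤ Fintype.card V := by
  classical
  set O := {v // v ∉ Set.range φ} with hO
  set e := Fintype.equivFin O
  have hcard : Fintype.card O + (s + 2 * r) = Fintype.card V := by
    have h1 := Fintype.card_subtype_compl (fun v => v ∈ Set.range φ)
    have h2 : Fintype.card {v // v ∈ Set.range φ} = s + 2 * r := by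
      rw [← Fintype.card_congr (Equiv.ofInjective φ hφ)]
      simp [mul_comm]
    have h3 : Fintype.card {v // v ∈ Set.range φ} ≤ Fintype.card V := Fintype.card_subtype_le _
    have h4 : Fintype.card O = Fintype.card V - Fintype.card {v // v ∈ Set.range φ} := h1
    omega
  -- The centres of stars come first, then the pairs, and the independent set has the top label.
  let lS : Fin s ⊕ Fin r × Bool → ℕ :=
    Sum.elim (fun _ => Fintype.card O + r) (fun q => Fintype.card O + q.1)
  let l : V → ℕ := fun v => if hv : v ∈ Set.range φ then lS hv.choose else e ⟨v, hv⟩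
  have hlφ (u) : l (φ u) = lS u := by
    have hv : φ u ∈ Set.range φ := ⟨u, rfl⟩
    simp only [l, dif_pos hv]
    rw [hφ hv.choose_spec]
  have hlO (v) (hv : v ∉ Set.range φ) : l v = e ⟨v, hv⟩ := dif_neg hv
  have hlS (u) : Fintype.card O ≤ lS u ∧ lS u ≤ Fintype.card O + r := by
    rcases u with i | ⟨p, b⟩
    · exact ⟨Nat.le_add_right _ _, le_rfl⟩
    · have := p.2
      simp only [lS, Sum.elim_inr]
      omega
  have hsame (u v) (huv : l u = l v) : u = v ∨ ∃ x y, φ x = u ∧ φ y = v ∧ lS x = lS y := by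
    by_cases hu : u ∈ Set.range φ <;> by_cases hv : v ∈ Set.range φ
    · obtain ⟨x, rfl⟩ := hu
      obtain ⟨y, rfl⟩ := hv
      rw [hlφ, hlφ] at huv
      exact Or.inr ⟨x, y, rfl, rfl, huv⟩
    · obtain ⟨x, rfl⟩ := hu
      rw [hlφ, hlO _ hv] at huv
      have := hlS x
      have := (e ⟨v, hv⟩).2
      omega
    · obtain ⟨y, rfl⟩ := hv
      rw [hlφ, hlO _ hu] at huv
      have := hlS y
      have := (e ⟨u, hu⟩).2
      omega
    · rw [hlO _ hu, hlO _ hv] at huv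
      have := e.injective (Fin.ext huv)
      exact Or.inl (congrArg Subtype.val this)
  -- Two vertices of the copy with the same label lie both in the independent set or in one pair.
  have hlS_eq (x y) (hxy : lS x = lS y) :
      (∃ i j, x = .inl i ∧ y = .inl j) ∨ ∃ p b b', x = .inr (p, b) ∧ y = .inr (p, b') := by
    rcases x with i | ⟨p, b⟩ <;> rcases y with j | ⟨q, b'⟩
    · exact Or.inl ⟨i, j, rfl, rfl⟩
    · simp only [lS, Sum.elim_inl, Sum.elim_inr] at hxy
      omega
    · simp only [lS, Sum.elim_inl, Sum.elim_inr] at hxy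
      omega
    · simp only [lS, Sum.elim_inr] at hxy
      obtain rfl : p = q := Fin.ext (by omega)
      exact Or.inr ⟨p, b, b', rfl, rfl⟩
  have htw (u p b b') : G.Adj (φ u) (φ (.inr (p, b))) → G.Adj (φ u) (φ (.inr (p, b'))) := by
    have := h.2 u p
    cases b <;> cases b'
    exacts [id, this.1, this.2, id]
  have hbc : G.bc ≤ Fintype.card O + r := by
    refine G.bc_le_of_label l _ ?_ ?_ ?_
    · intro v
      by_cases hv : v ∈ Set.range φ
      · obtain ⟨x, rfl⟩ := hv
        rw [hlφ]
        exact (hlS x).2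
      · rw [hlO v hv]
        exact (e ⟨v, hv⟩).2.le.trans (Nat.le_add_right _ _)
    · intro u v huv hadj
      rcases hsame u v huv with rfl | ⟨x, y, rfl, rfl, hxy⟩
      · exact G.irrefl hadj
      rcases hlS_eq x y hxy with ⟨i, j, rfl, rfl⟩ | ⟨p, b, b', rfl, rfl⟩
      · exact h.1 i j hadj
      · exact G.irrefl (htw _ p b' b hadj)
    · intro u v w huv hlt hadj
      rcases hsame u v huv with rfl | ⟨x, y, rfl, rfl, hxy⟩
      · exact hadj
      have hw : w ∈ Set.range φ := by
        by_contra hw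
        rw [hlφ, hlO w hw] at hlt
        have := hlS x
        have := (e ⟨w, hw⟩).2
        omega
      obtain ⟨z, rfl⟩ := hw
      rcases hlS_eq x y hxy with ⟨i, j, rfl, rfl⟩ | ⟨p, b, b', rfl, rfl⟩
      · rw [hlφ, hlφ] at hlt
        have := (hlS z).2
        simp only [lS, Sum.elim_inl] at hlt this
        omega
      · exact (htw z p b b' hadj.symm).symm
  omega

/-! ### Graphs as a vector space over the field with two elements -/

/-- The graphs on `V` as a group under symmetric difference of edge sets, written as the symmetric
functions `V → V → ZMod 2` that vanish on the diagonal. -/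
def adjGroup (V : Type*) : AddSubgroup (V → V → ZMod 2) where
  carrier := {f | (∀ u v, f u v = f v u) ∧ ∀ u, f u u = 0}
  add_mem' := fun ha hb => ⟨fun u v => by simp [ha.1 u v, hb.1 u v],
    fun u => by simp [ha.2 u, hb.2 u]⟩
  zero_mem' := ⟨fun _ _ => rfl, fun _ => rfl⟩
  neg_mem' := fun ha => ⟨fun u v => by simp [ha.1 u v], fun u => by simp [ha.2 u]⟩

/-- The graph with a given adjacency function. -/
def ofAdj (f : adjGroup V) : SimpleGraph V where
  Adj u v := f.1 u v = 1
  symm := ⟨fun u v h => by rw [f.2.1]; exact h⟩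
  loopless := ⟨fun u h => by rw [f.2.2] at h; exact absurd h (by decide)⟩

lemma ofAdj_bijective : Function.Bijective (ofAdj (V := V)) := by
  classical
  constructor
  · intro f g h
    refine Subtype.ext (funext fun u => funext fun v => ?_)
    have h1 : (f.1 u v = 1) ↔ (g.1 u v = 1) := by
      have := congrArg (fun G : SimpleGraph V => G.Adj u v) h
      exact iff_of_eq this
    generalize f.1 u v = x at h1
    generalize g.1 u v = y at h1
    revert x y
    decide
  · intro G
    refine ⟨⟨fun u v => if G.Adj u v then 1 else 0, fun u v => by simp [G.adj_comm],
      fun u => by simp⟩, ?_⟩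
    ext u v
    simp [ofAdj]

section Copies

variable {ι π : Type*}

/-- The conditions of `IsTwinCopy` that only involve the vertices `φ u` with `u ∈ T`. -/
def twinSubgroup (φ : ι ⊕ π × Bool → V) (T : Set (ι ⊕ π × Bool)) : AddSubgroup (adjGroup V) where
  carrier := {f | (∀ i j, .inl i ∈ T → .inl j ∈ T → f.1 (φ (.inl i)) (φ (.inl j)) = 0) ∧
    ∀ u p, u ∈ T → .inr (p, false) ∈ T → .inr (p, true) ∈ T →
      f.1 (φ u) (φ (.inr (p, false))) = f.1 (φ u) (φ (.inr (p, true)))}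
  add_mem' := fun ha hb => ⟨fun i j hi hj => by simp [ha.1 i j hi hj, hb.1 i j hi hj],
    fun u p hu h0 h1 => by simp [ha.2 u p hu h0 h1, hb.2 u p hu h0 h1]⟩
  zero_mem' := ⟨fun _ _ _ _ => rfl, fun _ _ _ _ _ => rfl⟩
  neg_mem' := fun ha => ⟨fun i j hi hj => by simp [ha.1 i j hi hj],
    fun u p hu h0 h1 => by simp [ha.2 u p hu h0 h1]⟩

lemma isTwinCopy_ofAdj {φ : ι ⊕ π × Bool → V} {f : adjGroup V}
    (hf : f ∈ twinSubgroup φ Set.univ) : (ofAdj f).IsTwinCopy φ := by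
  refine ⟨fun i j h => ?_, fun u p => ?_⟩
  · have h0 := hf.1 i j trivial trivial
    have h1 : f.1 (φ (.inl i)) (φ (.inl j)) = 1 := h
    rw [h0] at h1
    exact absurd h1 (by decide)
  · change f.1 _ _ = 1 ↔ f.1 _ _ = 1
    rw [hf.2 u p trivial trivial trivial]

/-- The other vertex of a pair of twins; the vertices of the independent set are fixed. -/
def twin : ι ⊕ π × Bool → ι ⊕ π × Bool := Sum.map id (Prod.map id not)

/-- A graph satisfying the conditions common to two partite copies `φ` and `ψ` is a sum of a graph
in which `φ` is a twin copy and a graph in which `ψ` is. The first summand is the pullback of the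
given graph along the map that replaces each vertex of `φ` outside `ψ` by its twin, if that lies
in `ψ`, and isolates it otherwise; it agrees with the given graph on `ψ`. -/
lemma twinSubgroup_le_sup (κ : V → ι ⊕ π × Bool) {φ ψ : ι ⊕ π × Bool → V}
    (hφ : ∀ u, κ (φ u) = u) (hψ : ∀ u, κ (ψ u) = u) :
    twinSubgroup φ {u | φ u = ψ u} ≤ twinSubgroup φ Set.univ ⊔ twinSubgroup ψ Set.univ := by
  classical
  intro f hf
  set T : Set (ι ⊕ π × Bool) := {u | φ u = ψ u} with hT
  let ρ : ι ⊕ π × Bool → ι ⊕ π × Bool := fun u => if u ∈ T then u else twin u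
  let χ₀ : ι ⊕ π × Bool → ZMod 2 := fun u => if ρ u ∈ T then 1 else 0
  let P : V → Prop := fun w => w = φ (κ w) ∧ w ≠ ψ (κ w)
  let R : V → V := fun w => if P w then φ (ρ (κ w)) else w
  let χ : V → ZMod 2 := fun w => if P w then χ₀ (κ w) else 1
  have hPφ (u) : P (φ u) ↔ u ∉ T := by simp [P, hφ, hT]
  have hPψ (u) : ¬ P (ψ u) := by simp [P, hψ]
  have hRφ (u) : R (φ u) = φ (ρ u) := by
    by_cases hu : u ∈ T <;> simp [R, hPφ, hu, hφ, ρ]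
  have hχφ (u) : χ (φ u) = χ₀ u := by
    by_cases hu : u ∈ T <;> simp [χ, hPφ, hu, hφ, ρ, χ₀]
  let g : adjGroup V := ⟨fun v w => χ v * χ w * f.1 (R v) (R w),
    fun v w => by beta_reduce; rw [f.2.1 (R v)]; ring, fun v => by
      beta_reduce; rw [f.2.2, mul_zero]⟩
  have hg : g ∈ twinSubgroup φ Set.univ := by
    constructor
    · intro i j _ _
      change χ _ * χ _ * f.1 (R _) (R _) = 0
      rw [hχφ, hχφ, hRφ, hRφ]
      by_cases hi : ρ (.inl i) ∈ T
      · by_cases hj : ρ (.inl j) ∈ T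
        · have hρ (i : ι) : ρ (.inl i) = .inl i := by
            simp only [ρ, twin]
            split_ifs <;> rfl
          rw [hρ] at hi hj
          rw [hρ, hρ, hf.1 i j hi hj, mul_zero]
        · simp [χ₀, hj]
      · simp [χ₀, hi]
    · intro u p _ _ _
      change χ _ * χ _ * f.1 (R _) (R _) = χ _ * χ _ * f.1 (R _) (R _)
      rw [hχφ, hχφ, hχφ, hRφ, hRφ, hRφ]
      by_cases hu : ρ u ∈ T
      · by_cases h0 : (.inr (p, false) : ι ⊕ π × Bool) ∈ T <;>
          by_cases h1 : (.inr (p, true) : ι ⊕ π × Bool) ∈ T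
        · have hρ0 : ρ (.inr (p, false)) = .inr (p, false) := if_pos h0
          have hρ1 : ρ (.inr (p, true)) = .inr (p, true) := if_pos h1
          simp only [χ₀, hρ0, hρ1, h0, h1, hf.2 (ρ u) p hu h0 h1]
        · simp [χ₀, ρ, h0, h1, twin]
        · simp [χ₀, ρ, h0, h1, twin]
        · simp [χ₀, ρ, h0, h1, twin]
      · simp [χ₀, hu]
  have hagree (u v) : (f - g).1 (ψ u) (ψ v) = 0 := by
    change f.1 _ _ - χ _ * χ _ * f.1 (R _) (R _) = 0
    simp [χ, R, hPψ]
  have hfg : f - g ∈ twinSubgroup ψ Set.univ :=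
    ⟨fun i j _ _ => hagree _ _, fun u p _ _ _ => by rw [hagree, hagree]⟩
  rw [← add_sub_cancel g f]
  exact AddSubgroup.add_mem_sup hg hfg

instance [Finite V] : Finite (adjGroup V) := Subtype.finite

open scoped Classical in
/-- The conditions on `T` number at most one for each unordered pair in the independent part of `T`
(loops included), and one for each vertex of `T` and each pair of twins contained in `T`. -/
lemma index_twinSubgroup_le [Finite V] [Fintype ι] [Fintype π] (φ : ι ⊕ π × Bool → V)
    (T : Finset (ι ⊕ π × Bool)) :
    (twinSubgroup φ T).index ≤
      2 ^ (((Finset.univ.filter fun i => .inl i ∈ T).card + 1).choose 2 +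
        (Finset.univ.filter fun p => .inr (p, false) ∈ T ∧ .inr (p, true) ∈ T).card * T.card) := by
  set A : Finset ι := Finset.univ.filter fun i => .inl i ∈ T with hA
  set B : Finset π := Finset.univ.filter fun p => .inr (p, false) ∈ T ∧ .inr (p, true) ∈ T with hB
  let F : adjGroup V →+ ((A.sym2 ⊕ B ×ˢ T : Type _) → ZMod 2) :=
    { toFun := fun f => Sum.elim
        (fun e => Sym2.lift ⟨fun i j => f.1 (φ (.inl i)) (φ (.inl j)), fun i j => f.2.1 _ _⟩ e.1)
        (fun q => f.1 (φ q.1.2) (φ (.inr (q.1.1, false))) -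
          f.1 (φ q.1.2) (φ (.inr (q.1.1, true))))
      map_zero' := by
        ext x
        rcases x with ⟨e, he⟩ | q
        · induction e using Sym2.ind
          rfl
        · simp
      map_add' := fun f g => by
        ext x
        rcases x with ⟨e, he⟩ | q
        · induction e using Sym2.ind
          rfl
        · simp
          ring }
  have hker : F.ker ≤ twinSubgroup φ T := by
    intro f hf
    rw [AddMonoidHom.mem_ker] at hf
    constructor
    · intro i j hi hj
      have := congrFun hf (.inl ⟨s(i, j), by
        rw [Finset.mk_mem_sym2_iff]
        exact ⟨by simpa [hA] using hi, by simpa [hA] using hj⟩⟩)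
      exact this
    · intro u p hu h0 h1
      have := congrFun hf (.inr ⟨(p, u), by
        rw [Finset.mem_product]
        exact ⟨by simpa [hB] using ⟨h0, h1⟩, hu⟩⟩)
      exact sub_eq_zero.1 this
  calc (twinSubgroup φ T).index ≤ F.ker.index := AddSubgroup.index_antitone hker
    _ = Nat.card F.range := AddSubgroup.index_ker F
    _ ≤ Nat.card ((A.sym2 ⊕ (B ×ˢ T : Finset _)) → ZMod 2) :=
        Nat.card_le_card_of_injective _ Subtype.val_injective
    _ = _ := by
      rw [Nat.card_fun, Nat.card_sum, Nat.card_eq_finsetCard, Nat.card_eq_finsetCard,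
        Finset.card_sym2, Finset.card_product, Nat.card_zmod]

end Copies

/-! ### The uniform random graph -/

/-- The edge probability `1/2`, for which all graphs are equally likely. -/
noncomputable abbrev halfProb : unitInterval := ⟨1 / 2, by norm_num, by norm_num⟩

lemma binomialRandom_half_real_finset [Fintype V] (S : Finset (SimpleGraph V)) :
    (binomialRandom V halfProb).real S = S.card * (1 / 2) ^ (Nat.card V).choose 2 := by
  classical
  have hsing (G : SimpleGraph V) : (binomialRandom V halfProb).real {G} =
      (1 / 2) ^ (Nat.card V).choose 2 := by
    rw [MeasureTheory.measureReal_def, binomialRandom_singleton]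
    have h1 : unitInterval.toNNReal (unitInterval.symm halfProb) =
        unitInterval.toNNReal halfProb := by
      ext
      simp [halfProb]
      norm_num
    have h2 : G.edgeSet.ncard ≤ (Nat.card V).choose 2 := by
      rw [Nat.card_eq_fintype_card, ← coe_edgeFinset, Set.ncard_coe_finset]
      exact G.card_edgeFinset_le_card_choose_two
    rw [h1, ← pow_add, Nat.add_sub_cancel' h2]
    simp [halfProb]
  have : MeasurableSingletonClass (SimpleGraph V) := ⟨fun G => by
    have h := measurableEmbedding_edgeSet.measurable (measurableSet_singleton G.edgeSet)
    convert h
    ext H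
    simp⟩
  rw [← MeasureTheory.sum_measureReal_singleton]
  simp [hsing]

lemma natCard_simpleGraph [Finite V] :
    (Nat.card (SimpleGraph V) : ℝ) = 2 ^ (Nat.card V).choose 2 := by
  classical
  have := Fintype.ofFinite V
  have h := binomialRandom_half_real_finset (V := V) Finset.univ
  rw [Finset.coe_univ, MeasureTheory.probReal_univ, Finset.card_univ, one_div, inv_pow,
    ← div_eq_mul_inv, eq_div_iff (by positivity), one_mul] at h
  rw [Nat.card_eq_fintype_card (α := SimpleGraph V), ← h]

lemma binomialRandom_half_real [Fintype V] (S : Set (SimpleGraph V)) :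
    (binomialRandom V halfProb).real S * Nat.card (SimpleGraph V) = S.ncard := by
  classical
  have hS := binomialRandom_half_real_finset S.toFinset
  rw [Set.coe_toFinset] at hS
  rw [hS, natCard_simpleGraph, Set.ncard_eq_toFinset_card', mul_assoc, ← mul_pow]
  norm_num

/-! ### Existence of a twin copy -/

open scoped Classical in
/-- The partite copies are the choices of one vertex `emb (u, x u)` in each of the parts
`emb (u, ·)`. The second moment factorizes over the parts. -/
lemma binomialRandom_no_twinCopy_le [Fintype V] {s r m : ℕ}
    (emb : (Fin s ⊕ Fin r × Bool) × Fin m ↪ V) (hs : 0 < s)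
    (hm : 0 < m) {B : ℝ}
    (hB : ∀ T : Finset (Fin s ⊕ Fin r × Bool),
      (2 : ℝ) ^ (((Finset.univ.filter fun i => .inl i ∈ T).card + 1).choose 2 +
        (Finset.univ.filter fun p => .inr (p, false) ∈ T ∧ .inr (p, true) ∈ T).card * T.card) ≤
          B ^ T.card) :
    (binomialRandom V halfProb).real
      {G | ¬ ∃ φ : Fin s ⊕ Fin r × Bool → V, Function.Injective φ ∧ G.IsTwinCopy φ} ≤
      (1 + (B - 1) / m) ^ (s + 2 * r) - 1 := by
  have : Nonempty (Fin m) := ⟨⟨0, hm⟩⟩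
  have : Fintype (adjGroup V) := Fintype.ofFinite _
  have : Nonempty (Fin s) := ⟨⟨0, hs⟩⟩
  set S := Fin s ⊕ Fin r × Bool with hS
  have hk : Fintype.card S = s + 2 * r := by simp [hS, mul_comm]
  set U : (S → Fin m) → AddSubgroup (adjGroup V) :=
    fun x => twinSubgroup (fun u => emb (u, x u)) Set.univ with hU
  have : Nonempty (S × Fin m) := inferInstance
  let κ : V → S := fun v => (Function.invFun emb v).1
  have hκ (x : S → Fin m) (u : S) : κ (emb (u, x u)) = u := by
    simp only [κ]
    rw [Function.leftInverse_invFun emb.injective]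
  have hindex (x y : S → Fin m) :
      ((U x ⊔ U y).index : ℝ) ≤ ∏ u, if x u = y u then B else 1 := by
    set T : Finset S := Finset.univ.filter fun u => x u = y u with hT
    have hTs : {u | emb (u, x u) = emb (u, y u)} = (T : Set S) := by
      ext u
      simp [hT]
    have h1 : twinSubgroup (fun u => emb (u, x u)) (T : Set S) ≤ U x ⊔ U y := by
      rw [← hTs]
      exact twinSubgroup_le_sup κ (hκ x) (hκ y)
    have h2 : (U x ⊔ U y).index ≤ _ :=
      (AddSubgroup.index_antitone h1).trans (index_twinSubgroup_le _ T)
    have h3 : ((U x ⊔ U y).index : ℝ) ≤ _ := Nat.cast_le.2 h2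
    rw [Nat.cast_pow, Nat.cast_ofNat] at h3
    refine h3.trans (Eq.trans_le (by congr!) ((hB T).trans_eq ?_))
    rw [Finset.prod_ite]
    simp [hT]
  have hsum : ∑ x, ∑ y, ((U x ⊔ U y).index : ℝ) ≤
      (m : ℝ) ^ (s + 2 * r) * (m - 1 + B) ^ (s + 2 * r) := by
    calc ∑ x, ∑ y, ((U x ⊔ U y).index : ℝ)
        ≤ ∑ x : S → Fin m, ∑ y : S → Fin m, ∏ u, if x u = y u then B else 1 :=
          Finset.sum_le_sum fun x _ => Finset.sum_le_sum fun y _ => hindex x y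
      _ = ∑ x : S → Fin m, (m - 1 + B) ^ (s + 2 * r) := by
          refine Finset.sum_congr rfl fun x _ => ?_
          have h := Finset.prod_univ_sum (fun _ : S => (Finset.univ : Finset (Fin m)))
            (fun u z => if x u = z then B else 1)
          rw [Fintype.piFinset_univ] at h
          rw [← h]
          have h3 (u : S) : ∑ z : Fin m, (if x u = z then B else 1) = m - 1 + B := by
            have h4 (z : Fin m) : (if x u = z then B else 1) =
                1 + if x u = z then B - 1 else 0 := by
              split_ifs <;> ring
            simp only [h4, Finset.sum_add_distrib, Finset.sum_ite_eq, Finset.mem_univ, if_true]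
            simp
            ring
          simp only [h3, Finset.prod_const, Finset.card_univ, hk]
      _ = _ := by
          rw [Finset.sum_const, Finset.card_univ, Fintype.card_fun, Fintype.card_fin, hk]
          simp
  have hmain := AddSubgroup.card_avoiding_le U
  have hbad : {G : SimpleGraph V |
      ¬ ∃ φ : S → V, Function.Injective φ ∧ G.IsTwinCopy φ}.ncard ≤
      (Finset.univ.filter fun f : adjGroup V => ∀ x, f ∉ U x).card := by
    rw [← Set.ncard_coe_finset]
    refine le_trans (Set.ncard_le_ncard ?_ (Set.toFinite _)) (Set.ncard_image_le (f := ofAdj))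
    intro G hG
    obtain ⟨f, rfl⟩ := ofAdj_bijective.2 G
    refine ⟨f, ?_, rfl⟩
    rw [Finset.mem_coe, Finset.mem_filter]
    refine ⟨Finset.mem_univ _, fun x hx => hG ⟨_, ?_, isTwinCopy_ofAdj hx⟩⟩
    intro u v huv
    exact congrArg Prod.fst (emb.injective huv)
  have hcardΓ : Nat.card (SimpleGraph V) = Fintype.card (adjGroup V) := by
    rw [← Nat.card_eq_fintype_card]
    exact (Nat.card_congr (Equiv.ofBijective _ ofAdj_bijective)).symm
  have hpos : (0 : ℝ) < Fintype.card (adjGroup V) := by exact_mod_cast Fintype.card_pos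
  have hm' : (0 : ℝ) < m := by exact_mod_cast hm
  have hN : (Fintype.card (S → Fin m) : ℝ) = (m : ℝ) ^ (s + 2 * r) := by simp [hk]
  rw [hN] at hmain
  have hreal := binomialRandom_half_real
    {G : SimpleGraph V | ¬ ∃ φ : S → V, Function.Injective φ ∧ G.IsTwinCopy φ}
  rw [hcardΓ] at hreal
  have hbad' : _ ≤ ((Finset.univ.filter fun f : adjGroup V => ∀ x, f ∉ U x).card : ℝ) :=
    Nat.cast_le.2 hbad
  rw [← hreal] at hbad'
  have hfac : (m : ℝ) ^ (s + 2 * r) * (m - 1 + B) ^ (s + 2 * r) =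
      ((m : ℝ) ^ (s + 2 * r)) ^ 2 * (1 + (B - 1) / m) ^ (s + 2 * r) := by
    rw [← mul_pow, ← pow_mul, mul_comm (s + 2 * r) 2, pow_mul, ← mul_pow]
    congr 1
    field_simp
    ring
  rw [hfac] at hsum
  set M : ℝ := ((m : ℝ) ^ (s + 2 * r)) ^ 2 with hM
  have hMpos : 0 < M := by positivity
  refine le_of_mul_le_mul_right ?_ (mul_pos hMpos hpos)
  nlinarith [mul_le_mul_of_nonneg_left hbad' hMpos.le,
    mul_le_mul_of_nonneg_left hsum hpos.le]

/-! ### The independence number -/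

/-- A graph on `A` can be added to any graph on `V` in which `A` is independent. -/
lemma binomialRandom_isIndepSet_le [Fintype V] (A : Finset V) :
    (binomialRandom V halfProb).real {G | G.IsIndepSet A} ≤ (1 / 2) ^ A.card.choose 2 := by
  classical
  have hcard : (Nat.card (SimpleGraph A) : ℝ) = 2 ^ A.card.choose 2 := by
    rw [natCard_simpleGraph, Nat.card_eq_finsetCard]
  have hinj : {G : SimpleGraph V | G.IsIndepSet A}.ncard * Nat.card (SimpleGraph A) ≤
      Nat.card (SimpleGraph V) := by
    rw [← Nat.card_coe_set_eq, ← Nat.card_prod]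
    refine Nat.card_le_card_of_injective
      (fun q => q.1.1 ⊔ q.2.map (Function.Embedding.subtype (· ∈ A))) ?_
    have hA (q : {G : SimpleGraph V | G.IsIndepSet A} × SimpleGraph A) (a b : A) :
        ¬ q.1.1.Adj a b := by
      intro h
      exact q.1.2 a.2 b.2 h.ne h
    have hin (q : {G : SimpleGraph V | G.IsIndepSet A} × SimpleGraph A) (a b : A) :
        (q.1.1 ⊔ q.2.map (Function.Embedding.subtype (· ∈ A))).Adj a b ↔ q.2.Adj a b := by
      have := hA q a b
      rw [sup_adj, or_iff_right this]
      exact map_adj_apply (f := Function.Embedding.subtype (· ∈ A))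
    have hout (q : {G : SimpleGraph V | G.IsIndepSet A} × SimpleGraph A) (u v : V)
        (huv : ¬ (u ∈ A ∧ v ∈ A)) :
        (q.1.1 ⊔ q.2.map (Function.Embedding.subtype (· ∈ A))).Adj u v ↔ q.1.1.Adj u v := by
      rw [sup_adj, or_iff_left]
      rw [map_adj]
      rintro ⟨a, b, -, rfl, rfl⟩
      exact huv ⟨a.2, b.2⟩
    intro q q' h
    refine Prod.ext (Subtype.ext ?_) ?_
    · ext u v
      by_cases huv : u ∈ A ∧ v ∈ A
      · exact iff_of_false (hA q ⟨u, huv.1⟩ ⟨v, huv.2⟩) (hA q' ⟨u, huv.1⟩ ⟨v, huv.2⟩)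
      · rw [← hout q u v huv, ← hout q' u v huv]
        exact iff_of_eq (congrArg (fun G : SimpleGraph V => G.Adj u v) h)
    · ext a b
      rw [← hin q a b, ← hin q' a b]
      exact iff_of_eq (congrArg (fun G : SimpleGraph V => G.Adj a b) h)
  have h := binomialRandom_half_real {G : SimpleGraph V | G.IsIndepSet A}
  have hpos : (0 : ℝ) < Nat.card (SimpleGraph V) := by exact_mod_cast Nat.card_pos
  have hinj' : (({G : SimpleGraph V | G.IsIndepSet A}.ncard : ℝ)) * Nat.card (SimpleGraph A) ≤
      Nat.card (SimpleGraph V) := by exact_mod_cast hinj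
  rw [hcard, ← h] at hinj'
  rw [one_div, inv_pow, ← one_div, le_div_iff₀ (by positivity)]
  nlinarith

/-- The first moment bound for the number of independent sets of size `k ≥ 2 log₂ n`. -/
lemma binomialRandom_le_indepNum_le {n k : ℕ} (hk : n ^ 2 ≤ 2 ^ k) :
    (binomialRandom (Fin n) halfProb).real {G | k ≤ G.indepNum} ≤ 2 ^ k / k.factorial := by
  have hsub : {G : SimpleGraph (Fin n) | k ≤ G.indepNum} ⊆
      ⋃ A ∈ Finset.powersetCard k (Finset.univ : Finset (Fin n)),
        {G : SimpleGraph (Fin n) | G.IsIndepSet A} := by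
    intro G hG
    obtain ⟨I, hI⟩ := G.exists_isNIndepSet_indepNum
    obtain ⟨A, hAI, hA⟩ := Finset.exists_subset_card_eq (hG.trans hI.card_eq.ge)
    simp only [Set.mem_iUnion]
    refine ⟨A, Finset.mem_powersetCard.2 ⟨Finset.subset_univ _, hA⟩, ?_⟩
    exact Set.Pairwise.mono (by exact_mod_cast hAI) hI.isIndepSet
  have hle : (binomialRandom (Fin n) halfProb).real {G | k ≤ G.indepNum} ≤
      n.choose k * (1 / 2) ^ k.choose 2 := by
    refine (MeasureTheory.measureReal_mono hsub (MeasureTheory.measure_ne_top _ _)).trans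
      ((MeasureTheory.measureReal_biUnion_finset_le _ _).trans ?_)
    refine (Finset.sum_le_sum (g := fun _ => (1 / 2 : ℝ) ^ k.choose 2) fun A hA => ?_).trans_eq ?_
    · rw [← (Finset.mem_powersetCard.1 hA).2]
      exact binomialRandom_isIndepSet_le A
    · simp
  refine hle.trans ((mul_le_mul_of_nonneg_right (Nat.choose_le_pow_div k n) (by positivity)).trans ?_)
  rw [div_mul_eq_mul_div]
  refine div_le_div_of_nonneg_right ?_ (by positivity)
  rw [one_div, inv_pow, ← div_eq_mul_inv, div_le_iff₀ (by positivity), ← pow_add]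
  -- Squaring clears the half-integer exponent in `n ≤ 2 ^ (k / 2)`.
  refine le_of_sq_le_sq ?_ (by positivity)
  have h1 : 2 * k.choose 2 + k = k * k := by
    rcases k with _ | k
    · rfl
    · rw [Nat.choose_two_right, Nat.mul_div_cancel' (Nat.even_mul_pred_self _).two_dvd]
      simp
      ring
  have h2 : ((n : ℝ) ^ k) ^ 2 ≤ (2 : ℝ) ^ (k * k) := by
    rw [← pow_mul, mul_comm, pow_mul, pow_mul]
    exact pow_le_pow_left₀ (by positivity) (by exact_mod_cast hk) _
  refine h2.trans ?_
  rw [← pow_mul]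
  exact pow_le_pow_right₀ (by norm_num) (by omega)

/-! ### The choice of parameters -/

open scoped Classical in
/-- Every nonempty part `T` of a twin copy with `(9/5) log₂ n` independent vertices and
`(1/4) log₂ n` pairs imposes at most `(39/40) |T| log₂ n` conditions, so that its expected number of
occurrences is large. -/
lemma two_pow_conditions_le {s r : ℕ} {L : ℝ} (hL : 40 ≤ L) (hs : (s : ℝ) ≤ 9 / 5 * L)
    (hr : (r : ℝ) ≤ L / 4) (T : Finset (Fin s ⊕ Fin r × Bool)) :
    (2 : ℝ) ^ (((Finset.univ.filter fun i => .inl i ∈ T).card + 1).choose 2 +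
      (Finset.univ.filter fun p => .inr (p, false) ∈ T ∧ .inr (p, true) ∈ T).card * T.card) ≤
        ((2 : ℝ) ^ (39 / 40 * L)) ^ T.card := by
  set A : Finset (Fin s) := Finset.univ.filter fun i => .inl i ∈ T with hA
  set B : Finset (Fin r) :=
    Finset.univ.filter fun p => .inr (p, false) ∈ T ∧ .inr (p, true) ∈ T with hB
  have hAs : (A.card : ℝ) ≤ 9 / 5 * L :=
    le_trans (by exact_mod_cast (Finset.card_le_univ A).trans_eq (Fintype.card_fin s)) hs
  have hBr : (B.card : ℝ) ≤ L / 4 :=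
    le_trans (by exact_mod_cast (Finset.card_le_univ B).trans_eq (Fintype.card_fin r)) hr
  have hT : A.card + 2 * B.card ≤ T.card := by
    have h1 : (A.disjSum (B ×ˢ (Finset.univ : Finset Bool))).card = A.card + 2 * B.card := by
      simp [mul_comm]
    rw [← h1]
    refine Finset.card_le_card fun x hx => ?_
    rw [Finset.mem_disjSum] at hx
    rcases hx with ⟨i, hi, rfl⟩ | ⟨⟨p, b⟩, hp, rfl⟩
    · simpa [hA] using hi
    · have : .inr (p, false) ∈ T ∧ .inr (p, true) ∈ T := by simpa [hB] using hp
      cases b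
      exacts [this.1, this.2]
  have hT' : (A.card : ℝ) + 2 * B.card ≤ T.card := by exact_mod_cast hT
  rw [← Real.rpow_natCast, ← Real.rpow_natCast, ← Real.rpow_mul (by norm_num)]
  refine Real.rpow_le_rpow_of_exponent_le (by norm_num) ?_
  push_cast [Nat.cast_choose_two]
  have ha : (0 : ℝ) ≤ A.card := Nat.cast_nonneg _
  have hb : (0 : ℝ) ≤ B.card := Nat.cast_nonneg _
  generalize (A.card : ℝ) = a at *
  generalize (B.card : ℝ) = b at *
  generalize (T.card : ℝ) = t at *
  nlinarith [mul_nonneg (show 0 ≤ 39 / 40 * L - b by linarith) (sub_nonneg.2 hT'),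
    mul_nonneg ha (sub_nonneg.2 hAs), mul_nonneg hb (sub_nonneg.2 hAs),
    mul_nonneg ha (sub_nonneg.2 hBr), mul_nonneg hb (sub_nonneg.2 hBr),
    mul_nonneg ha (sub_nonneg.2 hL), mul_nonneg hb (sub_nonneg.2 hL)]

lemma tendsto_logb_two_natCast : Tendsto (fun n : ℕ => Real.logb 2 (n : ℝ)) atTop atTop :=
  (Real.tendsto_logb_atTop (by norm_num)).comp tendsto_natCast_atTop_atTop

lemma tendsto_logb_sq_mul_rpow :
    Tendsto (fun n : ℕ => 18 * (Real.logb 2 (n : ℝ) ^ 2 * (n : ℝ) ^ (-(1 / 40) : ℝ)))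
      atTop (𝓝 0) := by
  have h := (isLittleO_log_rpow_rpow_atTop (s := 1 / 40) 2 (by norm_num)).tendsto_div_nhds_zero.comp
    tendsto_natCast_atTop_atTop
  have h2 := h.const_mul (18 / Real.log 2 ^ 2)
  rw [mul_zero] at h2
  refine h2.congr fun n => ?_
  simp only [Function.comp, Real.logb, Real.rpow_neg (Nat.cast_nonneg n), div_pow, Real.rpow_ofNat]
  ring

/-- With high probability the random graph contains a twin copy that saves `(2 + 1/25) log₂ n`
bicliques. -/
lemma tendsto_binomialRandom_lt_bc :
    Tendsto (fun n : ℕ => (binomialRandom (Fin n) halfProb).real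
      {G | ¬ (G.bc : ℝ) ≤ n - (2 + 1 / 25) * Real.logb 2 n}) atTop (𝓝 0) := by
  have hlim : Tendsto (fun n : ℕ =>
      Real.exp (18 * (Real.logb 2 (n : ℝ) ^ 2 * (n : ℝ) ^ (-(1 / 40) : ℝ))) - 1) atTop (𝓝 0) := by
    have h := (Real.continuous_exp.tendsto 0).comp tendsto_logb_sq_mul_rpow
    simpa using h.sub_const 1
  refine squeeze_zero' (Eventually.of_forall fun n => MeasureTheory.measureReal_nonneg) ?_ hlim
  filter_upwards [tendsto_logb_two_natCast.eventually_ge_atTop 200, eventually_ge_atTop 1,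
    tendsto_logb_sq_mul_rpow.eventually_le_const (by norm_num : (0 : ℝ) < 1)] with n hL hn hsmall
  have hn' : (1 : ℝ) ≤ n := by exact_mod_cast hn
  have hn0 : (0 : ℝ) < n := by linarith
  set L := Real.logb 2 (n : ℝ) with hLdef
  set s := ⌊9 / 5 * L⌋₊ with hs
  set r := ⌊L / 4⌋₊ with hr
  have hs1 : (s : ℝ) ≤ 9 / 5 * L := Nat.floor_le (by linarith)
  have hr1 : (r : ℝ) ≤ L / 4 := Nat.floor_le (by linarith)
  have hs2 : 9 / 5 * L < s + 1 := Nat.lt_floor_add_one _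
  have hr2 : L / 4 < r + 1 := Nat.lt_floor_add_one _
  have hspos : 0 < s := Nat.floor_pos.2 (by linarith)
  set k := s + 2 * r with hk
  have hkpos : 0 < k := by omega
  have hkL : (k : ℝ) ≤ 3 * L := by
    rw [hk]
    push_cast
    linarith
  have hBn : (2 : ℝ) ^ (39 / 40 * L) = (n : ℝ) ^ (39 / 40 : ℝ) := by
    rw [mul_comm, Real.rpow_mul (by norm_num), hLdef,
      Real.rpow_logb (by norm_num) (by norm_num) hn0]
  have hkn : k ≤ n := by
    have h1 : (n : ℝ) ^ (-(1 / 40) : ℝ) * n = (n : ℝ) ^ (39 / 40 : ℝ) := by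
      rw [← Real.rpow_add_one hn0.ne']
      norm_num
    have h2 : (1 : ℝ) ≤ (n : ℝ) ^ (39 / 40 : ℝ) := Real.one_le_rpow hn' (by norm_num)
    have h3 : 18 * L ^ 2 * (n : ℝ) ^ (39 / 40 : ℝ) ≤ n := by
      rw [← h1]
      nlinarith
    have h4 : (k : ℝ) ≤ n := by nlinarith
    exact_mod_cast h4
  set m := n / k with hm
  have hmpos : 0 < m := Nat.div_pos hkn hkpos
  have hkm : k * m ≤ n := Nat.mul_div_le n k
  have hnkm : n ≤ 2 * k * m := by
    have h1 : n < k * (m + 1) := Nat.lt_mul_div_succ n hkpos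
    nlinarith
  have hcard : Fintype.card ((Fin s ⊕ Fin r × Bool) × Fin m) ≤ Fintype.card (Fin n) := by
    simpa [hk, mul_comm r 2] using hkm
  obtain ⟨emb⟩ := Function.Embedding.nonempty_of_card_le hcard
  have hbound := binomialRandom_no_twinCopy_le emb hspos hmpos
    (two_pow_conditions_le (by linarith) hs1 hr1)
  have hsub : {G : SimpleGraph (Fin n) | ¬ (G.bc : ℝ) ≤ n - (2 + 1 / 25) * L} ⊆
      {G | ¬ ∃ φ : Fin s ⊕ Fin r × Bool → Fin n, Function.Injective φ ∧ G.IsTwinCopy φ} := by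
    rintro G hG ⟨φ, hφ, hcopy⟩
    refine hG ?_
    have h1 := hcopy.bc_add_le hφ
    rw [Fintype.card_fin] at h1
    have h2 : (G.bc : ℝ) + (s + r) ≤ n := by exact_mod_cast h1
    linarith
  refine (MeasureTheory.measureReal_mono hsub (MeasureTheory.measure_ne_top _ _)).trans
    (hbound.trans (sub_le_sub_right ?_ 1))
  have hm0 : (0 : ℝ) < m := by exact_mod_cast hmpos
  set B := (2 : ℝ) ^ (39 / 40 * L) with hB
  have hB1 : 1 ≤ B := Real.one_le_rpow (by norm_num) (by linarith)
  have hx : 0 ≤ (B - 1) / m := div_nonneg (by linarith) hm0.le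
  calc (1 + (B - 1) / m) ^ k ≤ Real.exp ((B - 1) / m) ^ k := by
        refine pow_le_pow_left₀ (by linarith) ?_ _
        rw [add_comm]
        exact Real.add_one_le_exp _
    _ = Real.exp (k * ((B - 1) / m)) := (Real.exp_nat_mul _ _).symm
    _ ≤ _ := Real.exp_le_exp.2 ?_
  have hn2 : (n : ℝ) ≤ 2 * k * m := by exact_mod_cast hnkm
  have hBn' : B = (n : ℝ) ^ (-(1 / 40) : ℝ) * n := by
    rw [hBn, ← Real.rpow_add_one hn0.ne']
    norm_num
  have hy : 0 ≤ (n : ℝ) ^ (-(1 / 40) : ℝ) := Real.rpow_nonneg hn0.le _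
  have hk0 : (0 : ℝ) ≤ k := Nat.cast_nonneg _
  rw [← mul_div_assoc, div_le_iff₀ hm0]
  have hkk : (k : ℝ) ^ 2 ≤ 9 * L ^ 2 := by nlinarith
  calc (k : ℝ) * (B - 1) ≤ k * B := by nlinarith
    _ = k * (n : ℝ) ^ (-(1 / 40) : ℝ) * n := by rw [hBn']; ring
    _ ≤ k * (n : ℝ) ^ (-(1 / 40) : ℝ) * (2 * k * m) :=
        mul_le_mul_of_nonneg_left hn2 (mul_nonneg hk0 hy)
    _ = k ^ 2 * (2 * (n : ℝ) ^ (-(1 / 40) : ℝ) * m) := by ring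
    _ ≤ 9 * L ^ 2 * (2 * (n : ℝ) ^ (-(1 / 40) : ℝ) * m) :=
        mul_le_mul_of_nonneg_right hkk (by positivity)
    _ = _ := by ring

/-- With high probability the independence number is at most `2 log₂ n`. -/
lemma tendsto_binomialRandom_lt_indepNum :
    Tendsto (fun n : ℕ => (binomialRandom (Fin n) halfProb).real
      {G | ¬ (G.indepNum : ℝ) ≤ 2 * Real.logb 2 n}) atTop (𝓝 0) := by
  have hk : Tendsto (fun n : ℕ => ⌊2 * Real.logb 2 (n : ℝ)⌋₊ + 1) atTop atTop :=
    (tendsto_add_atTop_nat 1).comp (tendsto_nat_floor_atTop.comp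
      (tendsto_logb_two_natCast.const_mul_atTop (by norm_num : (0 : ℝ) < 2)))
  have hlim := (FloorSemiring.tendsto_pow_div_factorial_atTop (2 : ℝ)).comp hk
  refine squeeze_zero' (Eventually.of_forall fun n => MeasureTheory.measureReal_nonneg) ?_ hlim
  filter_upwards [eventually_ge_atTop 1] with n hn
  have hn0 : (0 : ℝ) < n := by exact_mod_cast hn
  set k := ⌊2 * Real.logb 2 (n : ℝ)⌋₊ + 1 with hkdef
  have hlt : 2 * Real.logb 2 (n : ℝ) < k := by
    rw [hkdef]
    exact_mod_cast Nat.lt_floor_add_one _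
  have hnk : n ^ 2 ≤ 2 ^ k := by
    have h1 : (n : ℝ) ^ 2 = 2 ^ (2 * Real.logb 2 (n : ℝ)) := by
      rw [mul_comm, Real.rpow_mul (by norm_num), Real.rpow_logb (by norm_num) (by norm_num) hn0,
        Real.rpow_ofNat]
    have h2 : (n : ℝ) ^ 2 ≤ 2 ^ k := by
      rw [h1, ← Real.rpow_natCast]
      exact Real.rpow_le_rpow_of_exponent_le (by norm_num) hlt.le
    exact_mod_cast h2
  refine (MeasureTheory.measureReal_mono ?_ (MeasureTheory.measure_ne_top _ _)).trans
    (binomialRandom_le_indepNum_le hnk)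
  intro G hG
  rw [Set.mem_ofPred_eq, not_le] at hG
  have h0 : 0 ≤ 2 * Real.logb 2 (n : ℝ) := by
    have := Real.logb_nonneg (b := 2) (by norm_num) (by exact_mod_cast hn : (1 : ℝ) ≤ n)
    linarith
  exact (Nat.floor_lt h0).2 hG

end SimpleGraph

theorem theorem1p1 :
    ∃ c : ℝ, 0 < c ∧
      Tendsto
        (fun n : ℕ =>
          SimpleGraph.binomialRandom (Fin n) (⟨1 / 2, by norm_num, by norm_num⟩ : unitInterval)
            {G : SimpleGraph (Fin n) |
              (G.bc : ℝ) ≤ (n : ℝ) - (2 + 2 * c) * Real.logb 2 (n : ℝ) ∧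
              (n : ℝ) - (2 + 2 * c) * Real.logb 2 (n : ℝ) ≤
                (n : ℝ) - (1 + c) * (G.indepNum : ℝ)})
        atTop (𝓝 1) := by
  refine ⟨1 / 50, by norm_num, ?_⟩
  set E : (n : ℕ) → Set (SimpleGraph (Fin n)) := fun n => {G |
    (G.bc : ℝ) ≤ (n : ℝ) - (2 + 2 * (1 / 50)) * Real.logb 2 (n : ℝ) ∧
      (n : ℝ) - (2 + 2 * (1 / 50)) * Real.logb 2 (n : ℝ) ≤
        (n : ℝ) - (1 + 1 / 50) * (G.indepNum : ℝ)} with hE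
  have hlow : Tendsto (fun n : ℕ => 1 -
      ((SimpleGraph.binomialRandom (Fin n) SimpleGraph.halfProb).real
        {G | ¬ (G.bc : ℝ) ≤ n - (2 + 1 / 25) * Real.logb 2 n} +
      (SimpleGraph.binomialRandom (Fin n) SimpleGraph.halfProb).real
        {G | ¬ (G.indepNum : ℝ) ≤ 2 * Real.logb 2 n})) atTop (𝓝 1) := by
    simpa using (SimpleGraph.tendsto_binomialRandom_lt_bc.add
      SimpleGraph.tendsto_binomialRandom_lt_indepNum).const_sub 1
  have hreal : Tendsto (fun n : ℕ =>
      (SimpleGraph.binomialRandom (Fin n) SimpleGraph.halfProb).real (E n)) atTop (𝓝 1) := by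
    refine tendsto_of_tendsto_of_tendsto_of_le_of_le hlow tendsto_const_nhds (fun n => ?_)
      fun n => MeasureTheory.measureReal_le_one
    beta_reduce
    rw [sub_le_iff_le_add]
    refine (MeasureTheory.probReal_univ
      (μ := SimpleGraph.binomialRandom (Fin n) SimpleGraph.halfProb)).symm.trans_le ?_
    refine le_trans (MeasureTheory.measureReal_mono ?_ (MeasureTheory.measure_ne_top _ _))
      ((MeasureTheory.measureReal_union_le (E n) _).trans
        (add_le_add_right (MeasureTheory.measureReal_union_le _ _) _))
    intro G _
    by_cases h1 : (G.bc : ℝ) ≤ n - (2 + 1 / 25) * Real.logb 2 n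
    · by_cases h2 : (G.indepNum : ℝ) ≤ 2 * Real.logb 2 n
      · left
        refine ⟨by linarith, by linarith⟩
      · exact Or.inr (Or.inr h2)
    · exact Or.inr (Or.inl h1)
  have h := ENNReal.tendsto_ofReal hreal
  rw [ENNReal.ofReal_one] at h
  exact h.congr fun n => MeasureTheory.ofReal_measureReal (MeasureTheory.measure_ne_top _ _)
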